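/- **Proposition (GCM worst-case rates).** Let $\alpha,\beta>-1$. For $L>0$, the Generalized Chebyshev Method GCM$(\alpha,\beta)$ applied to a differentiable $f:\mathbb{R}^d\to\mathbb{R}$ from $x_0$ generates, with $x_{-1}=x_0$ and $\delta_0=0$, for $t=0,1,2,\dots$, $$\delta_{t+1}=\frac{1}{a_t+\gamma_t\delta_t},\qquad x_{t+1}=x_t+(\delta_{t+1}a_t-1)(x_t-x_{t-1})+\delta_{t+1}b_t\nabla f(x_t),$$ where $$a_t=-\frac{2\left(\beta^2+\alpha\beta+(2t+1)(\alpha+\beta)+2t^2+2t\right)(2t+\alpha+\beta+1)}{2(t+1)(t+\alpha+\beta+1)(2t+\alpha+\beta)},$$ $$b_t=\frac{(2t+\alpha+\beta+1)(2t+\alpha+\beta+2)}{L(t+1)(t+\alpha+\beta+1)},\qquad \gamma_t=-\frac{(t+\alpha)(t+\beta)(2t+\alpha+\beta+2)}{(t+1)(t+\alpha+\beta+1)(2t+\alpha+\beta)},$$ and for $t=0$ common factors are cancelled: $a_0=-(\beta+1)$, $b_0=(\alpha+\beta+2)/L$ (and $\gamma_0\delta_0=0$). There are constants $C_1,C_2>0$,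 depending only on $\alpha$ and $\beta$, such that for every dimension $d$, every $L>0$, every convex $L$-smooth quadratic function $f:\mathbb{R}^d\to\mathbb{R}$ with a minimizer $x^\star$, every starting point $x_0$ and every $t\ge 1$, $$f(x_t)-f(x^\star)\le C_1L\,\|x_0-x^\star\|^2\,t^{e_3},\qquad \|\nabla f(x_t)\|^2\le C_2L^2\,\|x_0-x^\star\|^2\,t^{e_4},$$ with the exponents $$e_3=\begin{cases}2(\alpha-\beta)&\text{if }\alpha>\beta-1\text{ and }\alpha\ge-\tfrac12,\\-1-2\beta&\text{if }(\alpha\le\beta-1\text{ or }\alpha<-\tfrac12)\text{ and }\beta\le\tfrac12,\\-2&\text{otherwise,}\end{cases}$$ $$e_4=\begin{cases}2(\alpha-\beta)&\text{if }\alpha>\beta-2\text{ and }\alpha\ge-\tfrac12,\\-1-2\beta&\text{if }(\alpha\le\beta-2\text{ or }\alpha<-\tfrac12)\text{ and }\beta\le\tfrac32,\\-4&\text{otherwise.}\end{cases}$$ -/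

import Mathlib

open Set

/-- A quadratic function on `ℝ^d`: `f x = ½ ⟨x, H x⟩ + ⟨b, x⟩ + c` with `H` symmetric. -/
def IsQuadraticFunction {d : ℕ} (f : EuclideanSpace ℝ (Fin d) → ℝ) : Prop :=
  ∃ (H : EuclideanSpace ℝ (Fin d) →ₗ[ℝ] EuclideanSpace ℝ (Fin d))
    (b : EuclideanSpace ℝ (Fin d)) (c : ℝ), H.IsSymmetric ∧
      ∀ x, f x = 1 / 2 * inner ℝ x (H x) + inner ℝ b x + c

/-- `f` is `L`-smooth: differentiable with `L`-Lipschitz gradient. -/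
def IsLSmooth {d : ℕ} (L : ℝ) (f : EuclideanSpace ℝ (Fin d) → ℝ) : Prop :=
  Differentiable ℝ f ∧ ∀ x y, ‖gradient f x - gradient f y‖ ≤ L * ‖x - y‖

noncomputable section

/-! Coefficients of the Generalized Chebyshev Method. Index `t` is used in the step from `x_t` to
`x_{t+1}`: the shifted Jacobi polynomials `p_t(z) = P_t^{(α,β)}(2 z / L - 1)` satisfy
`p_{t+1}(z) = (a_t + b_t z) p_t(z) + γ_t p_{t-1}(z)`. At `t = 0` the common factors `α + β` and
`α + β + 1` of numerator and denominator are cancelled, so that nothing is divided by zero when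
`α + β ∈ {0, -1}`; the value of `γ_0` is irrelevant, as it is multiplied by `δ_0 = 0`. -/

/-- The coefficient `a_t`. -/
def gcmA (α β : ℝ) (t : ℕ) : ℝ :=
  if t = 0 then -(β + 1)
  else -((2 * (β ^ 2 + α * β + (2 * t + 1) * (α + β) + 2 * t ^ 2 + 2 * t)
        * (2 * t + α + β + 1))
      / (2 * (t + 1) * (t + α + β + 1) * (2 * t + α + β)))

/-- The coefficient `b_t`. -/
def gcmB (α β L : ℝ) (t : ℕ) : ℝ :=
  if t = 0 then (α + β + 2) / L
  else (2 * t + α + β + 1) * (2 * t + α + β + 2) / (L * (t + 1) * (t + α + β + 1))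

/-- The coefficient `γ_t`. -/
def gcmGamma (α β : ℝ) (t : ℕ) : ℝ :=
  -(((t + α) * (t + β) * (2 * t + α + β + 2))
      / ((t + 1) * (t + α + β + 1) * (2 * t + α + β)))

/-- `δ_0 = 0` and `δ_{t+1} = 1 / (a_t + γ_t δ_t)`. -/
def gcmDelta (α β : ℝ) : ℕ → ℝ
  | 0 => 0
  | t + 1 => 1 / (gcmA α β t + gcmGamma α β t * gcmDelta α β t)

/-- The iterates of the Generalized Chebyshev Method `GCM(α, β)` with smoothness parameter `L`,
applied to `f` from `x₀`:
`x_{t+1} = x_t + (δ_{t+1} a_t - 1) (x_t - x_{t-1}) + δ_{t+1} b_t ∇f(x_t)`, with `x_{-1} = x_0`. -/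
def gcmIterate {d : ℕ} (α β L : ℝ) (f : EuclideanSpace ℝ (Fin d) → ℝ)
    (x₀ : EuclideanSpace ℝ (Fin d)) : ℕ → EuclideanSpace ℝ (Fin d)
  | 0 => x₀
  | 1 => x₀ + (gcmDelta α β 1 * gcmB α β L 0) • gradient f x₀
  | t + 2 =>
      gcmIterate α β L f x₀ (t + 1)
        + (gcmDelta α β (t + 2) * gcmA α β (t + 1) - 1)
            • (gcmIterate α β L f x₀ (t + 1) - gcmIterate α β L f x₀ t)
        + (gcmDelta α β (t + 2) * gcmB α β L (t + 1))
            • gradient f (gcmIterate α β L f x₀ (t + 1))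

open Classical in
/-- The exponent of the rate for function values. -/
def gcmExponentValue (α β : ℝ) : ℝ :=
  if β - 1 < α ∧ -(1 / 2) ≤ α then 2 * (α - β)
  else if (α ≤ β - 1 ∨ α < -(1 / 2)) ∧ β ≤ 1 / 2 then -1 - 2 * β
  else -2

open Classical in
/-- The exponent of the rate for squared gradient norms. -/
def gcmExponentGradient (α β : ℝ) : ℝ :=
  if β - 2 < α ∧ -(1 / 2) ≤ α then 2 * (α - β)
  else if (α ≤ β - 2 ∨ α < -(1 / 2)) ∧ β ≤ 3 / 2 then -1 - 2 * β
  else -4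

end

/-!
The method is linear on quadratics: if `H` is the Hessian of `f` and `v` is an eigenvector with
eigenvalue `μ ∈ [0, L]`, then the component of `x_t - x⋆` along `v` is that of `x_0 - x⋆` times
`p_t(μ / L)`, where `p_t` is the Jacobi polynomial `P_t^{(α,β)}(2 z - 1)` divided by its value at
`z = 0` (`inner_gcmIterate_sub`). This rests on the three-term recurrence of the Jacobi polynomials,
which is checked on the coefficients of `p_t = ₂F₁(-t, t + α + β + 1; β + 1; z)`
(`eval_jacobiPoly_add_two`). Both rates thus reduce to bounds on `[0, 1]` of `z p_t(z)²` and
`z² p_t(z)²` respectively, of the form `C t ^ (2 e)` (`exists_pow_mul_sq_eval_jacobiPoly_le`).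

These bounds come from the hypergeometric equation of `p_t`, with `λ = t (t + α + β + 1)`, in three
zones.

* For `z ≤ ε / t²` the power series of `p_t` at `0` is dominated by a geometric series, so `p_t` is
  bounded, and its derivative is `O(λ)` (`abs_eval_jacobiPoly_le`).
* For `ε / t² ≤ z ≤ 1 - ε / t²` the substitution `z = sin² φ` turns the product `u` of `p_t` with
  powers of `sin φ` and `cos φ` into a solution of `u'' + 4 (λ + O(1 / (z (1 - z)))) u = 0`.
  The derivative of its energy relative to the energy is `O(λ^{-1/2} (z (1 - z))^{-3/2})` with
  respect to `z`, and the integral of this over the zone is bounded independently of `t`.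
  Gronwall's inequality therefore transports the size at `ε / t²` through the whole zone
  (`jacobiEnergy_le`), which gives
  `p_t(z)² ≤ C t^{-1-2β} z^{-β-1/2} (1-z)^{-α-1/2}` (`exists_sq_eval_jacobiPoly_le`).
* For `z ≥ 1 - ε / t²` the power series at `1` shows that `p_t` is comparable to its value at
  `1 - ε / t²`, which the previous zone controls (`abs_eval_jacobiPoly_le_right`).

The maximum of `z^k p_t(z)²` is then at most of the order of the largest of `t^{-2k}`, `t^{-1-2β}`
and `t^{2(α-β)}`, and in every case the stated exponent dominates all three.
-/

/-! ### Jacobi polynomials on the unit interval -/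

/-- The `k`-th coefficient of the hypergeometric polynomial `₂F₁(-t, t + α + β + 1; β + 1; z)`. -/
noncomputable def jacobiCoeff (α β : ℝ) (t k : ℕ) : ℝ :=
  ∏ j ∈ Finset.range k,
    (((j : ℝ) - t) * (j + t + α + β + 1)) / (((j : ℝ) + 1) * (j + β + 1))

/-- The Jacobi polynomial of degree `t` on `[0, 1]`, `z ↦ P_t^{(α,β)}(2 z - 1)`, divided by its
value at `z = 0`; it is written as the hypergeometric polynomial
`₂F₁(-t, t + α + β + 1; β + 1; z)`. -/
noncomputable def jacobiPoly (α β : ℝ) (t : ℕ) : Polynomial ℝ :=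
  ∑ k ∈ Finset.range (t + 1), Polynomial.monomial k (jacobiCoeff α β t k)

theorem jacobiCoeff_zero (α β : ℝ) (t : ℕ) : jacobiCoeff α β t 0 = 1 := by
  simp [jacobiCoeff]

theorem jacobiCoeff_succ (α β : ℝ) (t k : ℕ) :
    jacobiCoeff α β t (k + 1) = jacobiCoeff α β t k *
      ((((k : ℝ) - t) * (k + t + α + β + 1)) / (((k : ℝ) + 1) * (k + β + 1))) := by
  rw [jacobiCoeff, Finset.prod_range_succ, ← jacobiCoeff]

theorem jacobiCoeff_eq_zero (α β : ℝ) {t k : ℕ} (h : t < k) : jacobiCoeff α β t k = 0 :=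
  Finset.prod_eq_zero (Finset.mem_range.2 h) (by simp)

theorem coeff_jacobiPoly (α β : ℝ) (t k : ℕ) :
    (jacobiPoly α β t).coeff k = jacobiCoeff α β t k := by
  rw [jacobiPoly, Polynomial.finsetSum_coeff]
  simp only [Polynomial.coeff_monomial, Finset.sum_ite_eq', Finset.mem_range]
  split_ifs with h
  · rfl
  · exact (jacobiCoeff_eq_zero α β (by omega)).symm

theorem natDegree_jacobiPoly_le (α β : ℝ) (t : ℕ) : (jacobiPoly α β t).natDegree ≤ t := by
  rw [Polynomial.natDegree_le_iff_coeff_eq_zero]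
  intro k hk
  rw [coeff_jacobiPoly, jacobiCoeff_eq_zero α β hk]

/-- The coefficients of degree `t + 2` in terms of those of degree `t + 1`. -/
theorem jacobiCoeff_raise {α β : ℝ} (hα : -1 < α) (hβ : -1 < β) (t k : ℕ) :
    jacobiCoeff α β (t + 2) (k + 1) = jacobiCoeff α β (t + 1) k *
      (-((t + 2) * (t + α + β + k + 2) * (t + α + β + k + 3))
        / ((t + α + β + 2) * ((k + 1) * (k + β + 1)))) := by
  have ht : (0 : ℝ) ≤ t := t.cast_nonneg
  have h1 : (t : ℝ) + α + β + 2 ≠ 0 := by linarith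
  induction k with
  | zero =>
    have h2 : β + 1 ≠ 0 := by linarith
    simp only [jacobiCoeff_succ, jacobiCoeff_zero]
    push_cast
    simp only [zero_add]
    field_simp
    ring
  | succ k ih =>
    have hk : (0 : ℝ) ≤ k := k.cast_nonneg
    have h2 : (k : ℝ) + β + 1 ≠ 0 := by linarith
    have h3 : (k : ℝ) + 1 + β + 1 ≠ 0 := by linarith
    have h4 : (k : ℝ) + 1 ≠ 0 := by linarith
    have h5 : (k : ℝ) + 1 + 1 ≠ 0 := by linarith
    rw [jacobiCoeff_succ, ih, jacobiCoeff_succ]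
    push_cast
    field_simp
    ring

/-- The coefficients of degree `t` in terms of those of degree `t + 1`. -/
theorem jacobiCoeff_lower {β : ℝ} (α : ℝ) (hβ : -1 < β) (t k : ℕ) :
    jacobiCoeff α β t (k + 1) = jacobiCoeff α β (t + 1) k *
      (-((t + 1 - k) * (t - k) * (t + α + β + 1))
        / ((t + 1) * ((k + 1) * (k + β + 1)))) := by
  have ht : (0 : ℝ) ≤ t := t.cast_nonneg
  have h1 : (t : ℝ) + 1 ≠ 0 := by linarith
  induction k with
  | zero =>
    have h2 : β + 1 ≠ 0 := by linarith
    simp only [jacobiCoeff_succ, jacobiCoeff_zero]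
    push_cast
    simp only [zero_add]
    field_simp
    ring
  | succ k ih =>
    have hk : (0 : ℝ) ≤ k := k.cast_nonneg
    have h2 : (k : ℝ) + β + 1 ≠ 0 := by linarith
    have h3 : (k : ℝ) + 1 + β + 1 ≠ 0 := by linarith
    have h4 : (k : ℝ) + 1 ≠ 0 := by linarith
    have h5 : (k : ℝ) + 1 + 1 ≠ 0 := by linarith
    rw [jacobiCoeff_succ, ih, jacobiCoeff_succ]
    push_cast
    field_simp
    ring

/-! ### The recurrence of the method -/

/-- `δ_t = p_{t-1}(0) / p_t(0)` for the Jacobi polynomials `p_t` in their usual normalization. -/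
theorem gcmDelta_eq {α β : ℝ} (hα : -1 < α) (hβ : -1 < β) (t : ℕ) :
    gcmDelta α β t = -(t / (t + β)) := by
  induction t with
  | zero => simp [gcmDelta]
  | succ t ih =>
    rcases t with _ | t
    · have h2 : β + 1 ≠ 0 := by linarith
      have h3 : 1 + β ≠ 0 := by linarith
      have h4 : -(β + 1) ≠ 0 := neg_ne_zero.2 h2
      rw [gcmDelta, gcmDelta, gcmA, if_pos rfl, mul_zero, add_zero, Nat.cast_add, Nat.cast_zero,
        Nat.cast_one, zero_add]
      field_simp
      ring
    · have ht : (0 : ℝ) ≤ t := t.cast_nonneg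
      have h1 : (t : ℝ) + 1 + β ≠ 0 := by linarith
      have h2 : (t : ℝ) + 1 + 1 + β ≠ 0 := by linarith
      have h3 : (t : ℝ) + 1 + 1 ≠ 0 := by linarith
      have h4 : (t : ℝ) + 1 + α + β + 1 ≠ 0 := by linarith
      have h5 : 2 * ((t : ℝ) + 1) + α + β ≠ 0 := by linarith
      rw [gcmDelta, ih, gcmA, gcmGamma, if_neg (Nat.succ_ne_zero t)]
      push_cast
      have key : -(2 * (β ^ 2 + α * β + (2 * ((t : ℝ) + 1) + 1) * (α + β) + 2 * ((t : ℝ) + 1) ^ 2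
              + 2 * ((t : ℝ) + 1)) * (2 * ((t : ℝ) + 1) + α + β + 1) /
            (2 * ((t : ℝ) + 1 + 1) * ((t : ℝ) + 1 + α + β + 1) * (2 * ((t : ℝ) + 1) + α + β)))
          + -(((t : ℝ) + 1 + α) * ((t : ℝ) + 1 + β) * (2 * ((t : ℝ) + 1) + α + β + 2) /
            (((t : ℝ) + 1 + 1) * ((t : ℝ) + 1 + α + β + 1) * (2 * ((t : ℝ) + 1) + α + β)))
            * -(((t : ℝ) + 1) / ((t : ℝ) + 1 + β))
          = -(((t : ℝ) + 1 + 1 + β) / ((t : ℝ) + 1 + 1)) := by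
        field_simp
        ring
      rw [key, one_div, inv_neg, inv_div]

theorem eval_jacobiPoly_one {α β L : ℝ} (hα : -1 < α) (hβ : -1 < β) (hL : L ≠ 0) (μ : ℝ) :
    (jacobiPoly α β 1).eval (μ / L) = 1 + gcmDelta α β 1 * gcmB α β L 0 * μ := by
  have h2 : β + 1 ≠ 0 := by linarith
  have h3 : 1 + β ≠ 0 := by linarith
  rw [gcmDelta_eq hα hβ, gcmB, if_pos rfl, jacobiPoly]
  simp [Finset.sum_range_succ, jacobiCoeff_zero, jacobiCoeff_succ]
  field_simp
  ring

/-- The normalized Jacobi polynomials follow the recurrence of the method on an eigenvector of the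
Hessian with eigenvalue `μ`. -/
theorem eval_jacobiPoly_add_two {α β L : ℝ} (hα : -1 < α) (hβ : -1 < β) (hL : L ≠ 0) (μ : ℝ)
    (t : ℕ) :
    (jacobiPoly α β (t + 2)).eval (μ / L) = (jacobiPoly α β (t + 1)).eval (μ / L)
      + (gcmDelta α β (t + 2) * gcmA α β (t + 1) - 1)
        * ((jacobiPoly α β (t + 1)).eval (μ / L) - (jacobiPoly α β t).eval (μ / L))
      + gcmDelta α β (t + 2) * gcmB α β L (t + 1)
        * (μ * (jacobiPoly α β (t + 1)).eval (μ / L)) := by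
  have ht : (0 : ℝ) ≤ t := t.cast_nonneg
  have h1 : (t : ℝ) + 1 + β ≠ 0 := by linarith
  have h2 : (t : ℝ) + 2 + β ≠ 0 := by linarith
  have h4 : (t : ℝ) + 1 + α + β + 1 ≠ 0 := by linarith
  have h4' : (t : ℝ) + α + β + 2 ≠ 0 := by linarith
  have h5 : 2 * ((t : ℝ) + 1) + α + β ≠ 0 := by linarith
  have h6 : (t : ℝ) + 1 + 1 ≠ 0 := by linarith
  have h7 : (t : ℝ) + 1 ≠ 0 := by linarith
  have poly : jacobiPoly α β (t + 2) = jacobiPoly α β (t + 1)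
      + Polynomial.C (gcmDelta α β (t + 2) * gcmA α β (t + 1) - 1)
        * (jacobiPoly α β (t + 1) - jacobiPoly α β t)
      + Polynomial.C (gcmDelta α β (t + 2) * gcmB α β 1 (t + 1))
        * (Polynomial.X * jacobiPoly α β (t + 1)) := by
    ext k
    rcases k with _ | k
    · simp only [Polynomial.coeff_add, Polynomial.coeff_C_mul, Polynomial.coeff_sub,
        Polynomial.coeff_X_mul_zero, coeff_jacobiPoly, jacobiCoeff_zero]
      ring
    · have hk : (0 : ℝ) ≤ k := k.cast_nonneg
      have h8 : (k : ℝ) + β + 1 ≠ 0 := by linarith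
      have h9 : (k : ℝ) + 1 ≠ 0 := by linarith
      rw [Polynomial.coeff_add, Polynomial.coeff_add, Polynomial.coeff_C_mul,
        Polynomial.coeff_C_mul, Polynomial.coeff_sub, Polynomial.coeff_X_mul, coeff_jacobiPoly,
        coeff_jacobiPoly, coeff_jacobiPoly, coeff_jacobiPoly, jacobiCoeff_raise hα hβ t k,
        jacobiCoeff_lower α hβ t k, jacobiCoeff_succ α β (t + 1) k,
        gcmDelta_eq hα hβ, gcmA, gcmB, if_neg (Nat.succ_ne_zero t), if_neg (Nat.succ_ne_zero t)]
      push_cast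
      generalize jacobiCoeff α β (t + 1) k = c
      generalize (t : ℝ) = x at *
      generalize (k : ℝ) = y at *
      field_simp
      ring
  have hB : gcmB α β L (t + 1) * μ = gcmB α β 1 (t + 1) * (μ / L) := by
    rw [gcmB, gcmB, if_neg (Nat.succ_ne_zero t), if_neg (Nat.succ_ne_zero t)]
    push_cast
    field_simp
  have := congrArg (Polynomial.eval (μ / L)) poly
  simp only [Polynomial.eval_add, Polynomial.eval_mul, Polynomial.eval_C, Polynomial.eval_sub,
    Polynomial.eval_X] at this
  rw [this]
  linear_combination (-(gcmDelta α β (t + 2) * (jacobiPoly α β (t + 1)).eval (μ / L))) * hB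

/-! ### The hypergeometric equation -/

/-- `q` solves the hypergeometric equation of the Jacobi polynomials of degree `t` with exponent
`β` at `0` and `α` at `1`. -/
def IsJacobiSolution (α β : ℝ) (t : ℕ) (q : Polynomial ℝ) : Prop :=
  Polynomial.X * (1 - Polynomial.X) * q.derivative.derivative
    + (Polynomial.C (β + 1) - Polynomial.C (α + β + 2) * Polynomial.X) * q.derivative
    + Polynomial.C (t * (t + α + β + 1)) * q = 0

/-- The hypergeometric equation, read off coefficientwise. -/
theorem coeff_hypergeometric (α β : ℝ) (t k : ℕ) (q : Polynomial ℝ) :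
    (Polynomial.X * (1 - Polynomial.X) * q.derivative.derivative
      + (Polynomial.C (β + 1) - Polynomial.C (α + β + 2) * Polynomial.X) * q.derivative
      + Polynomial.C (t * (t + α + β + 1)) * q).coeff k
    = (k + 1) * (k + β + 1) * q.coeff (k + 1)
      + (t - k) * (k + t + α + β + 1) * q.coeff k := by
  have e : Polynomial.X * (1 - Polynomial.X) * q.derivative.derivative
      + (Polynomial.C (β + 1) - Polynomial.C (α + β + 2) * Polynomial.X) * q.derivative
      + Polynomial.C (t * (t + α + β + 1)) * q
      = Polynomial.X * q.derivative.derivative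
        - Polynomial.X * (Polynomial.X * q.derivative.derivative)
        + Polynomial.C (β + 1) * q.derivative
        - Polynomial.C (α + β + 2) * (Polynomial.X * q.derivative)
        + Polynomial.C (t * (t + α + β + 1)) * q := by ring
  rw [e]
  rcases k with _ | _ | k
  · simp only [Polynomial.coeff_add, Polynomial.coeff_sub, Polynomial.coeff_C_mul,
      Polynomial.coeff_X_mul_zero, Polynomial.coeff_derivative]
    push_cast
    ring
  · simp [Polynomial.coeff_derivative, Polynomial.mul_coeff_zero, Polynomial.coeff_X_mul,
      Polynomial.coeff_C_mul, -map_add, -map_mul]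
    ring
  · simp only [Polynomial.coeff_add, Polynomial.coeff_sub, Polynomial.coeff_C_mul,
      Polynomial.coeff_X_mul, Polynomial.coeff_derivative]
    push_cast
    ring

theorem isJacobiSolution_jacobiPoly {β : ℝ} (α : ℝ) (hβ : -1 < β) (t : ℕ) :
    IsJacobiSolution α β t (jacobiPoly α β t) := by
  unfold IsJacobiSolution
  ext k
  have hk : (0 : ℝ) ≤ k := k.cast_nonneg
  have h8 : (k : ℝ) + β + 1 ≠ 0 := by linarith
  have h9 : (k : ℝ) + 1 ≠ 0 := by linarith
  rw [coeff_hypergeometric, coeff_jacobiPoly, coeff_jacobiPoly, jacobiCoeff_succ,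
    Polynomial.coeff_zero]
  field_simp
  ring

/-- Reflection `z ↦ 1 - z` exchanges the two endpoints. -/
theorem IsJacobiSolution.reflect {α β : ℝ} {t : ℕ} {q : Polynomial ℝ}
    (h : IsJacobiSolution α β t q) :
    IsJacobiSolution β α t (q.comp (1 - Polynomial.X)) := by
  unfold IsJacobiSolution at h ⊢
  have := congrArg (fun r => r.comp (1 - Polynomial.X)) h
  simp only [Polynomial.add_comp, Polynomial.mul_comp, Polynomial.sub_comp, Polynomial.X_comp,
    Polynomial.one_comp, Polynomial.C_comp, Polynomial.zero_comp] at this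
  simp only [Polynomial.derivative_comp, Polynomial.derivative_mul, Polynomial.derivative_sub,
    Polynomial.derivative_X, Polynomial.derivative_one, Polynomial.derivative_zero]
  have e1 : (Polynomial.C (α + β + 2) : Polynomial ℝ)
      = Polynomial.C (α + 1) + Polynomial.C (β + 1) := by
    rw [← Polynomial.C_add]; congr 1; ring
  have e2 : (Polynomial.C (β + α + 2) : Polynomial ℝ)
      = Polynomial.C (α + 1) + Polynomial.C (β + 1) := by
    rw [← Polynomial.C_add]; congr 1; ring
  have e3 : (t : ℝ) * (t + β + α + 1) = t * (t + α + β + 1) := by ring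
  rw [e1] at this
  rw [e2, e3]
  linear_combination this

/-! ### Behaviour at the endpoints -/

/-- The coefficients of a solution grow at most geometrically with ratio `λ / (β + 1)`, where
`λ = t (t + α + β + 1)`, because the factor `(t - k) (k + t + α + β + 1) = λ - k (k + α + β + 1)`
in their recurrence lies in `[0, λ]` for `k ≤ t`. -/
theorem abs_coeff_le_of_isJacobiSolution {α β : ℝ} (hα : -1 < α) (hβ : -1 < β) {t : ℕ}
    {q : Polynomial ℝ} (h : IsJacobiSolution α β t q) (hq : q.natDegree ≤ t) (k : ℕ) :
    |q.coeff k| ≤ (t * (t + α + β + 1) / (β + 1)) ^ k * |q.coeff 0| := by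
  induction k with
  | zero => simp
  | succ k ih =>
    have hb : 0 < β + 1 := by linarith
    have hk0 : (0 : ℝ) ≤ k := k.cast_nonneg
    have ht0 : (0 : ℝ) ≤ t * (t + α + β + 1) := by
      rcases t with _ | t
      · simp
      · have : (0 : ℝ) ≤ t := t.cast_nonneg
        push_cast
        exact mul_nonneg (by linarith) (by linarith)
    rcases Nat.lt_or_ge t (k + 1) with hk | hk
    · rw [Polynomial.coeff_eq_zero_of_natDegree_lt (hq.trans_lt hk), abs_zero]
      positivity
    have hk1 : (k : ℝ) + 1 ≤ t := by exact_mod_cast hk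
    have hks : 0 ≤ (k : ℝ) * (k + α + β + 1) := by
      rcases k with _ | k
      · simp
      · have : (0 : ℝ) ≤ k := k.cast_nonneg
        push_cast
        exact mul_nonneg (by linarith) (by linarith)
    have hc := coeff_hypergeometric α β t k q
    unfold IsJacobiSolution at h
    rw [h, Polynomial.coeff_zero] at hc
    have hd : β + 1 ≤ (k + 1) * (k + β + 1) := by 
      nlinarith [mul_nonneg hk0 hk0, mul_nonneg hk0 hb.le]
    have e : (k + 1) * (k + β + 1) * |q.coeff (k + 1)|
        = (t - k) * (k + t + α + β + 1) * |q.coeff k| := by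
      have h1 : 0 ≤ (k + 1) * (k + β + 1) := hb.le.trans hd
      have h2 : 0 ≤ ((t : ℝ) - k) * (k + t + α + β + 1) :=
        mul_nonneg (by linarith) (by linarith)
      calc (k + 1) * (k + β + 1) * |q.coeff (k + 1)|
          = |(k + 1) * (k + β + 1) * q.coeff (k + 1)| := by rw [abs_mul, abs_of_nonneg h1]
        _ = |-((t - k) * (k + t + α + β + 1) * q.coeff k)| := by
          congr 1
          linarith
        _ = _ := by rw [abs_neg, abs_mul, abs_of_nonneg h2]
    have e2 : (β + 1) * |q.coeff (k + 1)| ≤ t * (t + α + β + 1) * |q.coeff k| :=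
      calc (β + 1) * |q.coeff (k + 1)| ≤ (k + 1) * (k + β + 1) * |q.coeff (k + 1)| := by gcongr
        _ = (t - k) * (k + t + α + β + 1) * |q.coeff k| := e
        _ ≤ _ := by
          refine mul_le_mul_of_nonneg_right ?_ (abs_nonneg _)
          linarith
    calc |q.coeff (k + 1)| ≤ t * (t + α + β + 1) / (β + 1) * |q.coeff k| := by
          rw [div_mul_eq_mul_div, le_div_iff₀ hb]
          linarith
      _ ≤ t * (t + α + β + 1) / (β + 1)
          * ((t * (t + α + β + 1) / (β + 1)) ^ k * |q.coeff 0|) := by gcongr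
      _ = _ := by ring

theorem sum_geometric_le_of_le {x c : ℝ} (hx : 0 ≤ x) (hc : c < 1) (h : x ≤ c) (n : ℕ) :
    ∑ k ∈ Finset.range n, x ^ k ≤ 1 / (1 - c) := by
  have h1 : 0 < 1 - x := by linarith
  calc ∑ k ∈ Finset.range n, x ^ k ≤ 1 / (1 - x) := by
        rw [le_div_iff₀ h1, geom_sum_mul_neg]
        linarith [pow_nonneg hx n]
    _ ≤ _ := by gcongr

theorem abs_eval_sub_le {q : Polynomial ℝ} {M A z : ℝ} (hM : 0 ≤ M) (hA : 0 ≤ A)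
    (h : ∀ k, |q.coeff k| ≤ M ^ k * A) (hz : 0 ≤ z) (hMz : M * z ≤ 1 / 4) :
    |q.eval z - q.coeff 0| ≤ A / 2 := by
  rw [Polynomial.eval_eq_sum_range' (n := q.natDegree + 2) (by omega), Finset.sum_range_succ']
  rw [pow_zero, mul_one, add_sub_cancel_right]
  have hMz0 : 0 ≤ M * z := mul_nonneg hM hz
  calc |∑ k ∈ Finset.range (q.natDegree + 1), q.coeff (k + 1) * z ^ (k + 1)|
      ≤ ∑ k ∈ Finset.range (q.natDegree + 1), |q.coeff (k + 1) * z ^ (k + 1)| :=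
        Finset.abs_sum_le_sum_abs _ _
    _ ≤ ∑ k ∈ Finset.range (q.natDegree + 1), (M * z) ^ k * (A * (M * z)) := by
        gcongr with k hk
        rw [abs_mul, abs_of_nonneg (pow_nonneg hz (k + 1))]
        calc |q.coeff (k + 1)| * z ^ (k + 1) ≤ M ^ (k + 1) * A * z ^ (k + 1) := by
              gcongr
              exact h _
          _ = _ := by ring
    _ = (∑ k ∈ Finset.range (q.natDegree + 1), (M * z) ^ k) * (A * (M * z)) := by
        rw [Finset.sum_mul]
    _ ≤ (1 / (1 - 1 / 4)) * (A * (1 / 4)) := by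
        gcongr
        exact sum_geometric_le_of_le hMz0 (by norm_num) hMz _
    _ ≤ A / 2 := by linarith

theorem abs_eval_derivative_le {q : Polynomial ℝ} {M A z : ℝ} (hM : 0 ≤ M) (hA : 0 ≤ A)
    (h : ∀ k, |q.coeff k| ≤ M ^ k * A) (hz : 0 ≤ z) (hMz : M * z ≤ 1 / 4) :
    |q.derivative.eval z| ≤ 2 * M * A := by
  rw [Polynomial.eval_eq_sum_range' (n := q.derivative.natDegree + 1) (by omega)]
  have hMz0 : 0 ≤ M * z := mul_nonneg hM hz
  calc |∑ k ∈ Finset.range (q.derivative.natDegree + 1), q.derivative.coeff k * z ^ k|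
      ≤ ∑ k ∈ Finset.range (q.derivative.natDegree + 1), |q.derivative.coeff k * z ^ k| :=
        Finset.abs_sum_le_sum_abs _ _
    _ ≤ ∑ k ∈ Finset.range (q.derivative.natDegree + 1), (2 * (M * z)) ^ k * (A * M) := by
        gcongr with k hk
        have hk2 : (k : ℝ) + 1 ≤ 2 ^ k := by exact_mod_cast Nat.lt_two_pow_self
        rw [abs_mul, abs_of_nonneg (pow_nonneg hz k), Polynomial.coeff_derivative, abs_mul,
          abs_of_nonneg (by positivity : (0 : ℝ) ≤ (k : ℝ) + 1)]
        calc |q.coeff (k + 1)| * ((k : ℝ) + 1) * z ^ k ≤ M ^ (k + 1) * A * 2 ^ k * z ^ k := by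
              gcongr
              exact h _
          _ = _ := by rw [mul_pow, mul_pow]; ring
    _ = (∑ k ∈ Finset.range (q.derivative.natDegree + 1), (2 * (M * z)) ^ k) * (A * M) := by
        rw [Finset.sum_mul]
    _ ≤ (1 / (1 - 1 / 2)) * (A * M) := by
        gcongr
        exact sum_geometric_le_of_le (by positivity) (by norm_num) (by linarith) _
    _ = 2 * M * A := by ring

/-! ### An energy estimate in the interior -/

/-- The coefficient `g` of the first-order term in the Prüfer-type quantity
`z (1 - z) p' + g p / 2`. -/
noncomputable def jacobiShift (α β z : ℝ) : ℝ := β + 1 / 2 - (α + β + 1) * z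

/-- The energy `u_φ² / 4 + λ u²` of `u = (sin φ)^{β+1/2} (cos φ)^{α+1/2} q(sin² φ)` as a function
of `z = sin² φ`; here `λ = t (t + α + β + 1)`. -/
noncomputable def jacobiEnergy (α β : ℝ) (t : ℕ) (q : Polynomial ℝ) (z : ℝ) : ℝ :=
  z ^ (β - 1 / 2) * (1 - z) ^ (α - 1 / 2) *
    ((z * (1 - z) * q.derivative.eval z + jacobiShift α β z * q.eval z / 2) ^ 2
      + t * (t + α + β + 1) * (z * (1 - z)) * q.eval z ^ 2)

/-- All terms of the derivative of the energy that are quadratic in `q` alone or in the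
Prüfer-type quantity alone cancel; what is left is a mixed term without the large factor `λ`. -/
theorem hasDerivAt_jacobiEnergy {α β : ℝ} {t : ℕ} {q : Polynomial ℝ}
    (h : IsJacobiSolution α β t q) {z : ℝ} (hz0 : 0 < z) (hz1 : z < 1) :
    HasDerivAt (jacobiEnergy α β t q)
      (z ^ (β - 1 / 2) * (1 - z) ^ (α - 1 / 2) / (z * (1 - z))
        * ((jacobiShift α β z - (1 - 2 * z)) * jacobiShift α β z / 2
            - (α + β + 1) * (z * (1 - z)))
        * ((z * (1 - z) * q.derivative.eval z + jacobiShift α β z * q.eval z / 2)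
          * q.eval z)) z := by
  have hw : 0 < 1 - z := by linarith
  have ode : z * (1 - z) * q.derivative.derivative.eval z
      + (β + 1 - (α + β + 2) * z) * q.derivative.eval z
      + t * (t + α + β + 1) * q.eval z = 0 := by
    have := congrArg (Polynomial.eval z) h
    simpa only [Polynomial.eval_add, Polynomial.eval_mul, Polynomial.eval_C, Polynomial.eval_sub,
      Polynomial.eval_X, Polynomial.eval_one, Polynomial.eval_zero] using this
  have d1 : HasDerivAt (fun z : ℝ => z ^ (β - 1 / 2))
      (z ^ (β - 1 / 2) * ((β - 1 / 2) / z)) z := by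
    refine HasDerivAt.congr_deriv
      ((hasDerivAt_id' z).rpow_const (p := β - 1 / 2) (Or.inl hz0.ne')) ?_
    rw [Real.rpow_sub_one hz0.ne']
    ring
  have d2 : HasDerivAt (fun z : ℝ => (1 - z) ^ (α - 1 / 2))
      (-((1 - z) ^ (α - 1 / 2) * ((α - 1 / 2) / (1 - z)))) z := by
    refine HasDerivAt.congr_deriv
      (((hasDerivAt_id' z).const_sub 1).rpow_const (p := α - 1 / 2) (Or.inl hw.ne')) ?_
    rw [Real.rpow_sub_one hw.ne']
    ring
  have dy : HasDerivAt (fun z : ℝ => z * (1 - z)) (1 - 2 * z) z := by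
    refine HasDerivAt.congr_deriv ((hasDerivAt_id' z).mul ((hasDerivAt_id' z).const_sub 1)) ?_
    ring
  have dg : HasDerivAt (jacobiShift α β) (-(α + β + 1)) z := by
    unfold jacobiShift
    refine HasDerivAt.congr_deriv
      (((hasDerivAt_id' z).const_mul (α + β + 1)).const_sub (β + 1 / 2)) ?_
    ring
  have dq := q.hasDerivAt z
  have dq' := q.derivative.hasDerivAt z
  have dm := (dy.mul dq').add ((dg.mul dq).div_const 2)
  have key := (d1.mul d2).mul ((dm.pow 2).add ((dy.const_mul (t * (t + α + β + 1))).mul (dq.pow 2)))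
  refine HasDerivAt.congr_deriv (key) ?_
  simp only [Pi.mul_apply, Pi.add_apply, Pi.pow_apply]
  generalize z ^ (β - 1 / 2) = V₁
  generalize (1 - z) ^ (α - 1 / 2) = V₂
  generalize q.derivative.derivative.eval z = r at *
  generalize q.derivative.eval z = p₁ at *
  generalize q.eval z = p at *
  have hr : r = -((β + 1 - (α + β + 2) * z) * p₁ + t * (t + α + β + 1) * p) / (z * (1 - z)) := by
    field_simp
    linarith
  rw [hr]
  unfold jacobiShift
  have := hz0.ne'
  have := hw.ne'
  push_cast
  field_simp
  ring

/-- An antiderivative of `(z (1 - z)) ^ (-3 / 2)`, the rate at which the energy may vary. -/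
theorem hasDerivAt_energyTime {z : ℝ} (hz0 : 0 < z) (hz1 : z < 1) :
    HasDerivAt (fun z : ℝ => 2 * (2 * z - 1) / √(z * (1 - z)))
      (1 / (z * (1 - z) * √(z * (1 - z)))) z := by
  have hw : 0 < 1 - z := by linarith
  have hy : 0 < z * (1 - z) := mul_pos hz0 hw
  have hs : 0 < √(z * (1 - z)) := Real.sqrt_pos.2 hy
  have dy : HasDerivAt (fun z : ℝ => z * (1 - z)) (1 - 2 * z) z := by
    refine HasDerivAt.congr_deriv ((hasDerivAt_id' z).mul ((hasDerivAt_id' z).const_sub 1)) ?_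
    ring
  have dn : HasDerivAt (fun z : ℝ => 2 * (2 * z - 1)) 4 z := by
    refine HasDerivAt.congr_deriv ((((hasDerivAt_id' z).const_mul 2).sub_const 1).const_mul 2) ?_
    norm_num
  refine HasDerivAt.congr_deriv (dn.div (dy.sqrt hy.ne') hs.ne') ?_
  have e : √(z * (1 - z)) ^ 2 = z * (1 - z) := Real.sq_sqrt hy.le
  generalize √(z * (1 - z)) = σ at *
  rw [← e]
  field_simp
  rw [e]
  ring

/-- A bound for the factor of the mixed term in the derivative of the energy. -/
noncomputable def energyConst (α β : ℝ) : ℝ :=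
  (|β + 1 / 2| + |α + β + 1| + 1) * (|β + 1 / 2| + |α + β + 1|) / 2 + |α + β + 1|

theorem energyConst_nonneg (α β : ℝ) : 0 ≤ energyConst α β := by
  unfold energyConst
  positivity

theorem abs_jacobiShift_le (α β : ℝ) {z : ℝ} (hz0 : 0 ≤ z) (hz1 : z ≤ 1) :
    |jacobiShift α β z| ≤ |β + 1 / 2| + |α + β + 1| := by
  unfold jacobiShift
  calc |β + 1 / 2 - (α + β + 1) * z| ≤ |β + 1 / 2| + |(α + β + 1) * z| := abs_sub _ _
    _ ≤ _ := by
      rw [abs_mul, abs_of_nonneg hz0]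
      gcongr
      exact mul_le_of_le_one_right (abs_nonneg _) hz1

theorem abs_le_energyConst (α β : ℝ) {z : ℝ} (hz0 : 0 ≤ z) (hz1 : z ≤ 1) :
    |(jacobiShift α β z - (1 - 2 * z)) * jacobiShift α β z / 2 - (α + β + 1) * (z * (1 - z))|
      ≤ energyConst α β := by
  have hg := abs_jacobiShift_le α β hz0 hz1
  have h1 : |1 - 2 * z| ≤ 1 := abs_le.2 ⟨by linarith, by linarith⟩
  have h2 : |z * (1 - z)| ≤ 1 := by
    rw [abs_of_nonneg (mul_nonneg hz0 (by linarith))]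
    nlinarith
  unfold energyConst
  refine (abs_sub _ _).trans (add_le_add ?_ ?_)
  · rw [abs_div, abs_mul, abs_two]
    gcongr
    exact (abs_sub _ _).trans (add_le_add hg h1)
  · rw [abs_mul]
    exact mul_le_of_le_one_right (abs_nonneg _) h2

/-- Gronwall's inequality for the energy. -/
theorem jacobiEnergy_le {α β : ℝ} {t : ℕ} {q : Polynomial ℝ} (h : IsJacobiSolution α β t q)
    (hl : 0 < (t : ℝ) * (t + α + β + 1)) {z₀ z : ℝ} (hz₀ : 0 < z₀) (hz : z₀ ≤ z) (hz1 : z < 1) :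
    jacobiEnergy α β t q z ≤ jacobiEnergy α β t q z₀ *
      Real.exp (energyConst α β / (2 * √(t * (t + α + β + 1)))
        * (2 * (2 * z - 1) / √(z * (1 - z)) - 2 * (2 * z₀ - 1) / √(z₀ * (1 - z₀)))) := by
  set κ := energyConst α β / (2 * √(t * (t + α + β + 1))) with hκ
  set A : ℝ → ℝ := fun z => 2 * (2 * z - 1) / √(z * (1 - z)) with hA
  set Φ : ℝ → ℝ := fun z => jacobiEnergy α β t q z * Real.exp (-(κ * A z)) with hΦ
  have dΦ : ∀ x, 0 < x → x < 1 → ∃ d, d ≤ 0 ∧ HasDerivAt Φ d x := by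
    intro x hx0 hx1
    have hw : 0 < 1 - x := by linarith
    have hy : 0 < x * (1 - x) := mul_pos hx0 hw
    have dE := hasDerivAt_jacobiEnergy h hx0 hx1
    have dA := (((hasDerivAt_energyTime hx0 hx1).const_mul κ).neg).exp
    refine ⟨_, ?_, dE.mul dA⟩
    have e1 : ∀ D X E a : ℝ, D ≤ κ * a * E → D * Real.exp X + E * (Real.exp X * -(κ * a)) ≤ 0 := by
      intro D X E a hD
      have := mul_nonneg (sub_nonneg.2 hD) (Real.exp_pos X).le
      linarith
    apply e1
    have hq := abs_le_energyConst α β hx0.le hx1.le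
    have hV : 0 < x ^ (β - 1 / 2) * (1 - x) ^ (α - 1 / 2) := by positivity
    unfold jacobiEnergy
    generalize x ^ (β - 1 / 2) * (1 - x) ^ (α - 1 / 2) = V at *
    generalize x * (1 - x) * q.derivative.eval x + jacobiShift α β x * q.eval x / 2 = m
    generalize q.eval x = p
    generalize (jacobiShift α β x - (1 - 2 * x)) * jacobiShift α β x / 2
      - (α + β + 1) * (x * (1 - x)) = c at *
    generalize x * (1 - x) = y at *
    rw [hκ]
    have hs : 0 < √y := Real.sqrt_pos.2 hy
    have hL : 0 < √((t : ℝ) * (t + α + β + 1)) := Real.sqrt_pos.2 hl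
    have es : √y ^ 2 = y := Real.sq_sqrt hy.le
    have eL : √((t : ℝ) * (t + α + β + 1)) ^ 2 = t * (t + α + β + 1) := Real.sq_sqrt hl.le
    generalize √((t : ℝ) * (t + α + β + 1)) = ℓ at *
    rw [← eL]
    generalize √y = σ at *
    have hmp : 2 * (ℓ * σ) * |m * p| ≤ m ^ 2 + ℓ ^ 2 * y * p ^ 2 := by
      rw [abs_mul, ← es, ← sq_abs m, ← sq_abs p]
      nlinarith [sq_nonneg (|m| - ℓ * σ * |p|)]
    calc V / y * c * (m * p) ≤ |V / y * c * (m * p)| := le_abs_self _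
      _ = V / y * |c| * |m * p| := by
        rw [abs_mul, abs_mul, abs_of_nonneg (div_nonneg hV.le hy.le)]
      _ ≤ V / y * energyConst α β * ((m ^ 2 + ℓ ^ 2 * y * p ^ 2) / (2 * (ℓ * σ))) := by
        have := energyConst_nonneg α β
        gcongr
        rw [le_div_iff₀ (by positivity)]
        linarith
      _ = _ := by
        field_simp
  have anti : AntitoneOn Φ (Icc z₀ z) := by
    apply antitoneOn_of_deriv_nonpos (convex_Icc _ _)
    · intro x hx
      obtain ⟨d, -, hd⟩ := dΦ x (hz₀.trans_le hx.1) (hx.2.trans_lt hz1)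
      exact hd.continuousAt.continuousWithinAt
    · intro x hx
      rw [interior_Icc] at hx
      obtain ⟨d, -, hd⟩ := dΦ x (hz₀.trans hx.1) (hx.2.trans hz1)
      exact hd.differentiableAt.differentiableWithinAt
    · intro x hx
      rw [interior_Icc] at hx
      obtain ⟨d, hd0, hd⟩ := dΦ x (hz₀.trans hx.1) (hx.2.trans hz1)
      rw [hd.deriv]
      exact hd0
  have := anti (left_mem_Icc.2 hz) (right_mem_Icc.2 hz) hz
  simp only [hΦ] at this
  calc jacobiEnergy α β t q z
      = jacobiEnergy α β t q z * Real.exp (-(κ * A z)) * Real.exp (κ * A z) := by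
        rw [mul_assoc, ← Real.exp_add, neg_add_cancel, Real.exp_zero, mul_one]
    _ ≤ jacobiEnergy α β t q z₀ * Real.exp (-(κ * A z₀)) * Real.exp (κ * A z) := by gcongr
    _ = _ := by
        rw [mul_assoc, ← Real.exp_add]
        congr 2
        ring

/-! ### Uniform bounds on the unit interval -/

/-- At distance `ε / t²` from an endpoint, the power series of a solution regular at this endpoint
is dominated by a geometric series of ratio `1 / 4`, and `λ z ≤ 1 / 4` for
`λ = t (t + α + β + 1)`. -/
structure IsEndpointScale (α β ε : ℝ) : Prop where
  pos : 0 < ε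
  le : ε ≤ 1 / 4
  bound : ∀ t : ℕ, 1 ≤ t → (t : ℝ) * (t + α + β + 1) * (ε / (t : ℝ) ^ 2) ≤ 1 / 4
  left : ∀ t : ℕ, 1 ≤ t → (t : ℝ) * (t + α + β + 1) / (β + 1) * (ε / (t : ℝ) ^ 2) ≤ 1 / 4
  right : ∀ t : ℕ, 1 ≤ t → (t : ℝ) * (t + α + β + 1) / (α + 1) * (ε / (t : ℝ) ^ 2) ≤ 1 / 4

theorem exists_isEndpointScale {α β : ℝ} (hα : -1 < α) (hβ : -1 < β) :
    ∃ ε, IsEndpointScale α β ε := by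
  have ha : 0 < α + 1 := by linarith
  have hb : 0 < β + 1 := by linarith
  set c := min 1 (min (α + 1) (β + 1)) with hc
  have hc0 : 0 < c := lt_min one_pos (lt_min ha hb)
  have hc1 : c ≤ 1 := min_le_left _ _
  have hca : c ≤ α + 1 := (min_le_right _ _).trans (min_le_left _ _)
  have hcb : c ≤ β + 1 := (min_le_right _ _).trans (min_le_right _ _)
  set M := 1 + |α + β + 1| with hM
  have hM1 : 1 ≤ M := le_add_of_nonneg_right (abs_nonneg _)
  have hM0 : 0 < M := by linarith
  have key : ∀ t : ℕ, 1 ≤ t →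
      (t : ℝ) * (t + α + β + 1) * (c / (4 * M) / (t : ℝ) ^ 2) ≤ c / 4 := by
    intro t ht
    have ht1 : (1 : ℝ) ≤ t := by exact_mod_cast ht
    have ht0 : (0 : ℝ) < t := by linarith
    have h1 : (t : ℝ) + α + β + 1 ≤ M * t := by
      have := le_abs_self (α + β + 1)
      nlinarith [abs_nonneg (α + β + 1)]
    calc (t : ℝ) * (t + α + β + 1) * (c / (4 * M) / (t : ℝ) ^ 2)
        ≤ (t : ℝ) * (M * t) * (c / (4 * M) / (t : ℝ) ^ 2) := by gcongr
      _ = c / 4 := by field_simp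
  refine ⟨c / (4 * M), by positivity, ?_, fun t ht => (key t ht).trans (by linarith),
    fun t ht => ?_, fun t ht => ?_⟩
  · rw [div_le_iff₀ (by positivity)]
    linarith
  · rw [div_mul_eq_mul_div, div_le_iff₀ hb]
    linarith [key t ht]
  · rw [div_mul_eq_mul_div, div_le_iff₀ ha]
    linarith [key t ht]

theorem Real.rpow_le_add_of_mem_Icc {a b w : ℝ} (r : ℝ) (ha : 0 < a) (haw : a ≤ w) (hwb : w ≤ b) :
    w ^ r ≤ a ^ r + b ^ r := by
  have hw : 0 < w := ha.trans_le haw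
  have h1 : 0 < a ^ r := Real.rpow_pos_of_pos ha r
  have h2 : 0 < b ^ r := Real.rpow_pos_of_pos (hw.trans_le hwb) r
  rcases le_total 0 r with hr | hr
  · exact (Real.rpow_le_rpow hw.le hwb hr).trans (by linarith)
  · exact (Real.rpow_le_rpow_of_nonpos ha haw hr).trans (by linarith)

/-- `λ = t (t + α + β + 1)` is of the order of `t²`. -/
theorem mul_sq_le_eigenvalue (α β : ℝ) {t : ℕ} (ht : 1 ≤ t) :
    min 1 (α + β + 2) * (t : ℝ) ^ 2 ≤ t * (t + α + β + 1) := by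
  have ht1 : (1 : ℝ) ≤ t := by exact_mod_cast ht
  have ht0 : (0 : ℝ) ≤ t := by linarith
  have h : min 1 (α + β + 2) * (t : ℝ) ≤ t + α + β + 1 := by
    rcases le_total 0 (α + β + 1) with h | h
    · have := mul_le_mul_of_nonneg_right (min_le_left 1 (α + β + 2)) ht0
      linarith
    · have := mul_le_mul_of_nonneg_right (min_le_right 1 (α + β + 2)) ht0
      nlinarith
  calc min 1 (α + β + 2) * (t : ℝ) ^ 2 = t * (min 1 (α + β + 2) * (t : ℝ)) := by ring
    _ ≤ _ := by gcongr

theorem abs_eval_jacobiPoly_le {α β ε : ℝ} (hα : -1 < α) (hβ : -1 < β)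
    (hε : IsEndpointScale α β ε) {t : ℕ} (ht : 1 ≤ t) {z : ℝ} (hz0 : 0 ≤ z)
    (hz : z ≤ ε / (t : ℝ) ^ 2) :
    |(jacobiPoly α β t).eval z| ≤ 3 / 2 ∧
      |(jacobiPoly α β t).derivative.eval z| ≤ 2 * (t * (t + α + β + 1) / (β + 1)) := by
  have hb : 0 < β + 1 := by linarith
  have ht1 : (1 : ℝ) ≤ t := by exact_mod_cast ht
  have hM : 0 ≤ (t : ℝ) * (t + α + β + 1) / (β + 1) :=
    div_nonneg (mul_nonneg (by linarith) (by linarith)) hb.le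
  have hc := abs_coeff_le_of_isJacobiSolution hα hβ (isJacobiSolution_jacobiPoly α hβ t)
    (natDegree_jacobiPoly_le α β t)
  have hMz := (mul_le_mul_of_nonneg_left hz hM).trans (hε.left t ht)
  have h0 : (jacobiPoly α β t).coeff 0 = 1 := by rw [coeff_jacobiPoly, jacobiCoeff_zero]
  have h1 := abs_eval_sub_le hM (abs_nonneg _) hc hz0 hMz
  have h2 := abs_eval_derivative_le hM (abs_nonneg _) hc hz0 hMz
  rw [h0, abs_one] at h1 h2
  refine ⟨?_, by linarith⟩
  rw [abs_le] at h1 ⊢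
  constructor <;> linarith [h1.1, h1.2]

/-- Near the endpoint `1` the polynomial is comparable to its value at distance `ε / t²`, so that
its actual size there need not be known. -/
theorem abs_eval_jacobiPoly_le_right {α β ε : ℝ} (hα : -1 < α) (hβ : -1 < β)
    (hε : IsEndpointScale α β ε) {t : ℕ} (ht : 1 ≤ t) {z : ℝ} (hz1 : z ≤ 1)
    (hz : 1 - ε / (t : ℝ) ^ 2 ≤ z) :
    |(jacobiPoly α β t).eval z| ≤ 3 * |(jacobiPoly α β t).eval (1 - ε / (t : ℝ) ^ 2)| := by
  have ha : 0 < α + 1 := by linarith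
  have hε0 := hε.pos
  have ht1 : (1 : ℝ) ≤ t := by exact_mod_cast ht
  have hM : 0 ≤ (t : ℝ) * (t + β + α + 1) / (α + 1) :=
    div_nonneg (mul_nonneg (by linarith) (by linarith)) ha.le
  set q := (jacobiPoly α β t).comp (1 - Polynomial.X) with hq
  have hdeg : q.natDegree ≤ t := by
    refine Polynomial.natDegree_comp_le.trans ?_
    have h1 : (1 - Polynomial.X : Polynomial ℝ).natDegree ≤ 1 := by compute_degree
    calc _ ≤ t * 1 := Nat.mul_le_mul (natDegree_jacobiPoly_le α β t) h1
      _ = t := mul_one t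
  have hc := abs_coeff_le_of_isJacobiSolution hβ hα
    (isJacobiSolution_jacobiPoly α hβ t).reflect hdeg
  have hMε : (t : ℝ) * (t + β + α + 1) / (α + 1) * (ε / (t : ℝ) ^ 2) ≤ 1 / 4 := by
    have := hε.right t ht
    rwa [add_right_comm (t : ℝ) α β] at this
  have hev : ∀ x, q.eval x = (jacobiPoly α β t).eval (1 - x) := by
    intro x
    simp [hq, Polynomial.eval_comp]
  have h1 := abs_eval_sub_le hM (abs_nonneg _) hc (by linarith : 0 ≤ 1 - z)
    ((mul_le_mul_of_nonneg_left (by linarith : 1 - z ≤ ε / (t : ℝ) ^ 2) hM).trans hMε)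
  have h2 := abs_eval_sub_le hM (abs_nonneg _) hc (by positivity : 0 ≤ ε / (t : ℝ) ^ 2) hMε
  rw [hev] at h1 h2
  rw [sub_sub_cancel] at h1
  have h3 := abs_sub_abs_le_abs_sub ((jacobiPoly α β t).eval z) (q.coeff 0)
  have h4 := abs_sub_abs_le_abs_sub (q.coeff 0) ((jacobiPoly α β t).eval (1 - ε / (t : ℝ) ^ 2))
  rw [abs_sub_comm (q.coeff 0)] at h4
  linarith

/-- The energy at distance `ε / t²` from the endpoint `0`. -/
theorem exists_jacobiEnergy_left_le {α β ε : ℝ} (hα : -1 < α) (hβ : -1 < β)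
    (hε : IsEndpointScale α β ε) :
    ∃ C, 0 < C ∧ ∀ t : ℕ, 1 ≤ t →
      jacobiEnergy α β t (jacobiPoly α β t) (ε / (t : ℝ) ^ 2)
        ≤ C * ((t : ℝ) ^ 2) ^ (1 / 2 - β) := by
  have hε0 := hε.pos
  refine ⟨ε ^ (β - 1 / 2) * ((3 / 4) ^ (α - 1 / 2) + 1 ^ (α - 1 / 2)) *
    ((1 / 2 + (|β + 1 / 2| + |α + β + 1|) * (3 / 2) / 2) ^ 2 + 1 / 4 * (3 / 2) ^ 2),
    by positivity, fun t ht => ?_⟩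
  have ht1 : (1 : ℝ) ≤ t := by exact_mod_cast ht
  have hx1 : (1 : ℝ) ≤ (t : ℝ) ^ 2 := one_le_pow₀ ht1
  have hl : 0 ≤ (t : ℝ) * (t + α + β + 1) := mul_nonneg (by linarith) (by linarith)
  have hb := hε.bound t ht
  have hL := hε.left t ht
  have hε4 := hε.le
  have hbb : 0 < β + 1 := by linarith
  have hz0 : 0 < ε / (t : ℝ) ^ 2 := by positivity
  have hz4 : ε / (t : ℝ) ^ 2 ≤ 1 / 4 := (div_le_self hε0.le hx1).trans hε4
  have hpow : (ε / (t : ℝ) ^ 2) ^ (β - 1 / 2)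
      = ε ^ (β - 1 / 2) * ((t : ℝ) ^ 2) ^ (1 / 2 - β) := by
    rw [Real.div_rpow hε0.le (by positivity), div_eq_mul_inv, ← Real.rpow_neg (by positivity),
      neg_sub]
  obtain ⟨hp, hp'⟩ := abs_eval_jacobiPoly_le hα hβ hε ht hz0.le le_rfl
  unfold jacobiEnergy
  rw [hpow]
  generalize ε / (t : ℝ) ^ 2 = z at *
  have hg := abs_jacobiShift_le α β hz0.le (by linarith : z ≤ 1)
  have hw : 0 < 1 - z := by linarith
  have hm : |z * (1 - z) * (jacobiPoly α β t).derivative.eval z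
      + jacobiShift α β z * (jacobiPoly α β t).eval z / 2|
      ≤ 1 / 2 + (|β + 1 / 2| + |α + β + 1|) * (3 / 2) / 2 := by
    refine (abs_add_le _ _).trans (add_le_add ?_ ?_)
    · rw [abs_mul, abs_of_pos (mul_pos hz0 hw)]
      calc z * (1 - z) * |(jacobiPoly α β t).derivative.eval z|
          ≤ z * 1 * (2 * (t * (t + α + β + 1) / (β + 1))) := by
            gcongr
            linarith
        _ ≤ 1 / 2 := by linarith
    · rw [abs_div, abs_mul, abs_two]
      gcongr
  have hm2 := sq_le_sq' (abs_le.1 hm).1 (abs_le.1 hm).2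
  have hp2 : (jacobiPoly α β t).eval z ^ 2 ≤ (3 / 2) ^ 2 :=
    sq_le_sq' (abs_le.1 hp).1 (abs_le.1 hp).2
  have hly : t * (t + α + β + 1) * (z * (1 - z)) ≤ 1 / 4 := by
    calc t * (t + α + β + 1) * (z * (1 - z)) ≤ t * (t + α + β + 1) * (z * 1) := by
          gcongr
          linarith
      _ ≤ 1 / 4 := by linarith
  have hwp := Real.rpow_le_add_of_mem_Icc (α - 1 / 2) (by norm_num : (0 : ℝ) < 3 / 4)
    (by linarith : 3 / 4 ≤ 1 - z) (by linarith : 1 - z ≤ 1)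
  have hly0 : 0 ≤ t * (t + α + β + 1) * (z * (1 - z)) := mul_nonneg hl (mul_pos hz0 hw).le
  calc _ ≤ ε ^ (β - 1 / 2) * ((t : ℝ) ^ 2) ^ (1 / 2 - β)
        * ((3 / 4) ^ (α - 1 / 2) + 1 ^ (α - 1 / 2)) *
        ((1 / 2 + (|β + 1 / 2| + |α + β + 1|) * (3 / 2) / 2) ^ 2 + 1 / 4 * (3 / 2) ^ 2) := by
        gcongr
    _ = _ := by ring

/-- The classical bound for Jacobi polynomials away from the endpoints, in the normalization
`p_t(0) = 1`, obtained by transporting the energy from the left end of the zone. -/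
theorem exists_sq_eval_jacobiPoly_le {α β ε : ℝ} (hα : -1 < α) (hβ : -1 < β)
    (hε : IsEndpointScale α β ε) :
    ∃ C, 0 < C ∧ ∀ t : ℕ, 1 ≤ t → ∀ z, ε / (t : ℝ) ^ 2 ≤ z → z ≤ 1 - ε / (t : ℝ) ^ 2 →
      (jacobiPoly α β t).eval z ^ 2
        ≤ C * ((t : ℝ) ^ 2) ^ (-1 / 2 - β) * (z ^ (-1 / 2 - β) * (1 - z) ^ (-1 / 2 - α)) := by
  obtain ⟨C, hC, hE⟩ := exists_jacobiEnergy_left_le hα hβ hε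
  have hε0 := hε.pos
  have hε4 := hε.le
  set m := min 1 (α + β + 2) with hm
  have hm0 : 0 < m := lt_min one_pos (by linarith)
  refine ⟨C * Real.exp (energyConst α β * 2 / √(m * (ε / 2))) / m, by positivity,
    fun t ht z hz hz1 => ?_⟩
  have ht1 : (1 : ℝ) ≤ t := by exact_mod_cast ht
  have hx1 : (1 : ℝ) ≤ (t : ℝ) ^ 2 := one_le_pow₀ ht1
  have hl := mul_sq_le_eigenvalue α β ht
  have hEt := hE t ht
  rw [← hm] at hl
  have hx0 : 0 < (t : ℝ) ^ 2 := by linarith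
  have hl0 : 0 < (t : ℝ) * (t + α + β + 1) := lt_of_lt_of_le (by positivity) hl
  have hz0 : 0 < ε / (t : ℝ) ^ 2 := by positivity
  have hz4 : ε / (t : ℝ) ^ 2 ≤ 1 / 4 := (div_le_self hε0.le hx1).trans hε4
  have hzp : 0 < z := hz0.trans_le hz
  have hw : 0 < 1 - z := by linarith
  have gron := jacobiEnergy_le (isJacobiSolution_jacobiPoly α hβ t) hl0 hz0 hz (by linarith)
  have hK := energyConst_nonneg α β
  -- the exponent in Gronwall's inequality is bounded because `λ z (1 - z)` is bounded below
  have hexp : energyConst α β / (2 * √(t * (t + α + β + 1)))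
        * (2 * (2 * z - 1) / √(z * (1 - z))
          - 2 * (2 * (ε / (t : ℝ) ^ 2) - 1) / √(ε / (t : ℝ) ^ 2 * (1 - ε / (t : ℝ) ^ 2)))
      ≤ energyConst α β * 2 / √(m * (ε / 2)) := by
    have hy : ∀ x, ε / (t : ℝ) ^ 2 ≤ x → x ≤ 1 - ε / (t : ℝ) ^ 2 →
        |2 * (2 * x - 1) / √(x * (1 - x))| ≤ 2 / √(ε / (t : ℝ) ^ 2 / 2) := by
      intro x hx hx'
      have : 0 < √(ε / (t : ℝ) ^ 2 / 2) := Real.sqrt_pos.2 (by positivity)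
      rw [abs_div, abs_of_nonneg (Real.sqrt_nonneg _)]
      refine div_le_div₀ (by norm_num) ?_ this (Real.sqrt_le_sqrt ?_)
      · rw [abs_le]
        constructor <;> linarith
      · nlinarith [mul_nonneg (sub_nonneg.2 hx) (sub_nonneg.2 hx')]
    have h1 := (abs_le.1 (hy z hz hz1)).2
    have h2 := (abs_le.1 (hy _ le_rfl (by linarith : ε / (t : ℝ) ^ 2 ≤ 1 - ε / (t : ℝ) ^ 2))).1
    have hs : 0 < √(m * (t : ℝ) ^ 2) := Real.sqrt_pos.2 (by positivity)
    have hs' : 0 < √(ε / (t : ℝ) ^ 2 / 2) := Real.sqrt_pos.2 (by positivity)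
    calc _ ≤ energyConst α β / (2 * √(t * (t + α + β + 1))) * (4 / √(ε / (t : ℝ) ^ 2 / 2)) := by
          refine mul_le_mul_of_nonneg_left ?_ (by positivity)
          have : 4 / √(ε / (t : ℝ) ^ 2 / 2)
            = 2 / √(ε / (t : ℝ) ^ 2 / 2) + 2 / √(ε / (t : ℝ) ^ 2 / 2) := by ring
          linarith
      _ ≤ energyConst α β / (2 * √(m * (t : ℝ) ^ 2)) * (4 / √(ε / (t : ℝ) ^ 2 / 2)) := by
          gcongr
      _ = energyConst α β * 2 / (√(m * (t : ℝ) ^ 2) * √(ε / (t : ℝ) ^ 2 / 2)) := by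
          field_simp
          ring
      _ = _ := by
          rw [← Real.sqrt_mul (by positivity)]
          congr 2
          field_simp
  have hEz : jacobiEnergy α β t (jacobiPoly α β t) z
      ≤ C * ((t : ℝ) ^ 2) ^ (1 / 2 - β) * Real.exp (energyConst α β * 2 / √(m * (ε / 2))) := by
    refine gron.trans ?_
    gcongr
  have hlow : m * (t : ℝ) ^ 2 * (z ^ (β + 1 / 2) * (1 - z) ^ (α + 1 / 2))
      * (jacobiPoly α β t).eval z ^ 2 ≤ jacobiEnergy α β t (jacobiPoly α β t) z := by
    unfold jacobiEnergy
    have e1 : z ^ (β + 1 / 2) = z ^ (β - 1 / 2) * z := by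
      rw [← Real.rpow_add_one hzp.ne']
      congr 1
      ring
    have e2 : (1 - z) ^ (α + 1 / 2) = (1 - z) ^ (α - 1 / 2) * (1 - z) := by
      rw [← Real.rpow_add_one hw.ne']
      congr 1
      ring
    rw [e1, e2]
    calc _ ≤ (t * (t + α + β + 1)) * (z ^ (β - 1 / 2) * z * ((1 - z) ^ (α - 1 / 2) * (1 - z)))
          * (jacobiPoly α β t).eval z ^ 2 := by gcongr
      _ = z ^ (β - 1 / 2) * (1 - z) ^ (α - 1 / 2)
          * (0 + t * (t + α + β + 1) * (z * (1 - z)) * (jacobiPoly α β t).eval z ^ 2) := by ring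
      _ ≤ _ := by
        gcongr
        positivity
  have e3 : z ^ (-1 / 2 - β) = (z ^ (β + 1 / 2))⁻¹ := by
    rw [← Real.rpow_neg hzp.le]
    congr 1
    ring
  have e4 : (1 - z) ^ (-1 / 2 - α) = ((1 - z) ^ (α + 1 / 2))⁻¹ := by
    rw [← Real.rpow_neg hw.le]
    congr 1
    ring
  have e5 : ((t : ℝ) ^ 2) ^ (-1 / 2 - β) = ((t : ℝ) ^ 2) ^ (1 / 2 - β) / (t : ℝ) ^ 2 := by
    rw [← Real.rpow_sub_one hx0.ne']
    congr 1
    ring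
  rw [e3, e4, e5]
  have p1 : 0 < z ^ (β + 1 / 2) := by positivity
  have p2 : 0 < (1 - z) ^ (α + 1 / 2) := by positivity
  have := hlow.trans hEz
  calc (jacobiPoly α β t).eval z ^ 2
      = m * (t : ℝ) ^ 2 * (z ^ (β + 1 / 2) * (1 - z) ^ (α + 1 / 2))
        * (jacobiPoly α β t).eval z ^ 2
        / (m * (t : ℝ) ^ 2 * (z ^ (β + 1 / 2) * (1 - z) ^ (α + 1 / 2))) := by field_simp
    _ ≤ C * ((t : ℝ) ^ 2) ^ (1 / 2 - β) * Real.exp (energyConst α β * 2 / √(m * (ε / 2)))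
        / (m * (t : ℝ) ^ 2 * (z ^ (β + 1 / 2) * (1 - z) ^ (α + 1 / 2))) := by gcongr
    _ = _ := by field_simp

/-- The bound over the whole interval. The three conditions on the exponent `e` correspond to the
possible locations of the maximum: near `0`, in the interior, and near `1`. -/
theorem exists_pow_mul_sq_eval_jacobiPoly_le {α β : ℝ} (hα : -1 < α) (hβ : -1 < β) (k : ℕ) {e : ℝ}
    (he₀ : -k ≤ e) (he : -1 / 2 - β ≤ e) (he₁ : α - β ≤ e) :
    ∃ C, 0 < C ∧ ∀ t : ℕ, 1 ≤ t → ∀ z, 0 ≤ z → z ≤ 1 →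
      z ^ k * (jacobiPoly α β t).eval z ^ 2 ≤ C * ((t : ℝ) ^ 2) ^ e := by
  obtain ⟨ε, hε⟩ := exists_isEndpointScale hα hβ
  obtain ⟨C, hC, hint⟩ := exists_sq_eval_jacobiPoly_le hα hβ hε
  have hε0 := hε.pos
  have hε4 := hε.le
  set C₁ : ℝ := (3 / 2) ^ 2 with hC₁
  set C₂ : ℝ := C * ((1 / 2) ^ (-1 / 2 - α) + 1 ^ (-1 / 2 - α))
    * (ε ^ (k + (-1 / 2 - β)) + 1) with hC₂
  set C₃ : ℝ := C * ((1 / 2) ^ (-1 / 2 - β) + 1 ^ (-1 / 2 - β))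
    * (ε ^ (-1 / 2 - α) + 1) with hC₃
  have hC₁0 : 0 < C₁ := by positivity
  have hC₂0 : 0 < C₂ := by positivity
  have hC₃0 : 0 < C₃ := by positivity
  refine ⟨C₁ + C₂ + 9 * C₃, by positivity, fun t ht z hz0 hz1 => ?_⟩
  have ht1 : (1 : ℝ) ≤ t := by exact_mod_cast ht
  have hx1 : (1 : ℝ) ≤ (t : ℝ) ^ 2 := one_le_pow₀ ht1
  have hx0 : 0 < (t : ℝ) ^ 2 := by linarith
  have hxe : 0 < ((t : ℝ) ^ 2) ^ e := by positivity
  have hmono : ∀ r, r ≤ e → ((t : ℝ) ^ 2) ^ r ≤ ((t : ℝ) ^ 2) ^ e :=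
    fun r hr => Real.rpow_le_rpow_of_exponent_le hx1 hr
  have hε1 : 0 < ε / (t : ℝ) ^ 2 := by positivity
  have hεx : ε / (t : ℝ) ^ 2 ≤ 1 / 4 := (div_le_self hε0.le hx1).trans hε4
  have hεr : ∀ r : ℝ, (ε / (t : ℝ) ^ 2) ^ r = ε ^ r * ((t : ℝ) ^ 2) ^ (-r) := by
    intro r
    rw [Real.div_rpow hε0.le hx0.le, div_eq_mul_inv, ← Real.rpow_neg hx0.le]
  have key₃ : ∀ z, 1 / 2 ≤ z → z ≤ 1 - ε / (t : ℝ) ^ 2 →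
      (jacobiPoly α β t).eval z ^ 2 ≤ C₃ * ((t : ℝ) ^ 2) ^ e := by
    intro z hz hz'
    have hzp : 0 < z := by linarith
    have hw : 0 < 1 - z := by linarith
    have h1 := Real.rpow_le_add_of_mem_Icc (-1 / 2 - β) (by norm_num) hz (by linarith : z ≤ 1)
    have h2 := Real.rpow_le_add_of_mem_Icc (-1 / 2 - α) hε1 (by linarith)
      (by linarith : 1 - z ≤ 1)
    rw [hεr, Real.one_rpow] at h2
    have h3 : ((t : ℝ) ^ 2) ^ (-1 / 2 - β) * ((t : ℝ) ^ 2) ^ (-(-1 / 2 - α))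
        ≤ ((t : ℝ) ^ 2) ^ e := by
      rw [← Real.rpow_add hx0]
      exact hmono _ (by linarith)
    calc (jacobiPoly α β t).eval z ^ 2
        ≤ C * ((t : ℝ) ^ 2) ^ (-1 / 2 - β) * (z ^ (-1 / 2 - β) * (1 - z) ^ (-1 / 2 - α)) :=
          hint t ht z (by linarith) hz'
      _ ≤ C * ((t : ℝ) ^ 2) ^ (-1 / 2 - β) * (((1 / 2) ^ (-1 / 2 - β) + 1 ^ (-1 / 2 - β))
          * (ε ^ (-1 / 2 - α) * ((t : ℝ) ^ 2) ^ (-(-1 / 2 - α)) + 1)) := by gcongr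
      _ = C * ((1 / 2) ^ (-1 / 2 - β) + 1 ^ (-1 / 2 - β)) * (ε ^ (-1 / 2 - α)
          * (((t : ℝ) ^ 2) ^ (-1 / 2 - β) * ((t : ℝ) ^ 2) ^ (-(-1 / 2 - α)))
          + ((t : ℝ) ^ 2) ^ (-1 / 2 - β)) := by ring
      _ ≤ C * ((1 / 2) ^ (-1 / 2 - β) + 1 ^ (-1 / 2 - β)) * (ε ^ (-1 / 2 - α)
          * ((t : ℝ) ^ 2) ^ e + ((t : ℝ) ^ 2) ^ e) := by
          gcongr
      _ = _ := by rw [hC₃]; ring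
  have hzk : z ^ k ≤ 1 := pow_le_one₀ hz0 hz1
  rcases le_total z (ε / (t : ℝ) ^ 2) with h | h
  · have hp := (abs_eval_jacobiPoly_le hα hβ hε ht hz0 h).1
    have hp2 : (jacobiPoly α β t).eval z ^ 2 ≤ C₁ := sq_le_sq' (abs_le.1 hp).1 (abs_le.1 hp).2
    have hz2 : z ^ k ≤ ((t : ℝ) ^ 2) ^ e := by
      calc z ^ k ≤ (1 / (t : ℝ) ^ 2) ^ k := by
            gcongr
            exact h.trans (by gcongr; linarith)
        _ = ((t : ℝ) ^ 2) ^ (-(k : ℝ)) := by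
            rw [Real.rpow_neg hx0.le, Real.rpow_natCast, one_div, inv_pow]
        _ ≤ _ := hmono _ he₀
    calc z ^ k * (jacobiPoly α β t).eval z ^ 2 ≤ ((t : ℝ) ^ 2) ^ e * C₁ := by gcongr
      _ ≤ _ := by nlinarith
  rcases le_total z (1 / 2) with h' | h'
  · have hzp : 0 < z := hε1.trans_le h
    have hw : 0 < 1 - z := by linarith
    have h1 := Real.rpow_le_add_of_mem_Icc (k + (-1 / 2 - β)) hε1 h hz1
    have h2 := Real.rpow_le_add_of_mem_Icc (-1 / 2 - α) (by norm_num : (0 : ℝ) < 1 / 2)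
      (by linarith : 1 / 2 ≤ 1 - z) (by linarith : 1 - z ≤ 1)
    rw [hεr, Real.one_rpow] at h1
    have h3 : ((t : ℝ) ^ 2) ^ (-1 / 2 - β) * ((t : ℝ) ^ 2) ^ (-(k + (-1 / 2 - β)))
        ≤ ((t : ℝ) ^ 2) ^ e := by
      rw [← Real.rpow_add hx0]
      exact hmono _ (by linarith)
    calc z ^ k * (jacobiPoly α β t).eval z ^ 2
        ≤ z ^ k * (C * ((t : ℝ) ^ 2) ^ (-1 / 2 - β)
            * (z ^ (-1 / 2 - β) * (1 - z) ^ (-1 / 2 - α))) := by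
          gcongr
          exact hint t ht z h (by linarith)
      _ = C * ((t : ℝ) ^ 2) ^ (-1 / 2 - β)
            * (z ^ (k + (-1 / 2 - β)) * (1 - z) ^ (-1 / 2 - α)) := by
          rw [Real.rpow_add hzp, Real.rpow_natCast]
          ring
      _ ≤ C * ((t : ℝ) ^ 2) ^ (-1 / 2 - β)
          * ((ε ^ (k + (-1 / 2 - β)) * ((t : ℝ) ^ 2) ^ (-(k + (-1 / 2 - β))) + 1)
            * ((1 / 2) ^ (-1 / 2 - α) + 1 ^ (-1 / 2 - α))) := by gcongr
      _ = C * ((1 / 2) ^ (-1 / 2 - α) + 1 ^ (-1 / 2 - α)) * (ε ^ (k + (-1 / 2 - β))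
          * (((t : ℝ) ^ 2) ^ (-1 / 2 - β) * ((t : ℝ) ^ 2) ^ (-(k + (-1 / 2 - β))))
          + ((t : ℝ) ^ 2) ^ (-1 / 2 - β)) := by ring
      _ ≤ C * ((1 / 2) ^ (-1 / 2 - α) + 1 ^ (-1 / 2 - α)) * (ε ^ (k + (-1 / 2 - β))
          * ((t : ℝ) ^ 2) ^ e + ((t : ℝ) ^ 2) ^ e) := by
          gcongr
      _ = C₂ * ((t : ℝ) ^ 2) ^ e := by rw [hC₂]; ring
      _ ≤ _ := by
        gcongr
        linarith
  have key : (jacobiPoly α β t).eval z ^ 2 ≤ 9 * (C₃ * ((t : ℝ) ^ 2) ^ e) := by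
    rcases le_total z (1 - ε / (t : ℝ) ^ 2) with h'' | h''
    · have := key₃ z h' h''
      have : 0 < C₃ * ((t : ℝ) ^ 2) ^ e := by positivity
      linarith
    · have h1 := abs_eval_jacobiPoly_le_right hα hβ hε ht hz1 h''
      have h2 := key₃ (1 - ε / (t : ℝ) ^ 2) (by linarith) le_rfl
      calc (jacobiPoly α β t).eval z ^ 2 = |(jacobiPoly α β t).eval z| ^ 2 := (sq_abs _).symm
        _ ≤ (3 * |(jacobiPoly α β t).eval (1 - ε / (t : ℝ) ^ 2)|) ^ 2 := by gcongr
        _ = 9 * (jacobiPoly α β t).eval (1 - ε / (t : ℝ) ^ 2) ^ 2 := by rw [mul_pow, sq_abs]; ring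
        _ ≤ _ := by gcongr
  calc z ^ k * (jacobiPoly α β t).eval z ^ 2 ≤ 1 * (9 * (C₃ * ((t : ℝ) ^ 2) ^ e)) := by gcongr
    _ = 9 * C₃ * ((t : ℝ) ^ 2) ^ e := by ring
    _ ≤ _ := by
      gcongr
      linarith

/-! ### Quadratic functions -/

section Quadratic

variable {d : ℕ} {f : EuclideanSpace ℝ (Fin d) → ℝ}
  {H : EuclideanSpace ℝ (Fin d) →ₗ[ℝ] EuclideanSpace ℝ (Fin d)}
  {b : EuclideanSpace ℝ (Fin d)} {c : ℝ}

theorem hasGradientAt_of_quadratic (hH : H.IsSymmetric)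
    (hf : ∀ x, f x = 1 / 2 * inner ℝ x (H x) + inner ℝ b x + c) (x : EuclideanSpace ℝ (Fin d)) :
    HasGradientAt f (H x + b) x := by
  rw [hasGradientAt_iff_hasFDerivAt]
  have h1 : HasFDerivAt (fun x => H x) H.toContinuousLinearMap x :=
    H.toContinuousLinearMap.hasFDerivAt
  have h2 := (((hasFDerivAt_id x).inner ℝ h1).const_mul (1 / 2 : ℝ)).add
    ((hasFDerivAt_const b x).inner ℝ (hasFDerivAt_id x))
  have h3 := h2.add_const c
  have hfe : f = fun x => 1 / 2 * inner ℝ x (H x) + inner ℝ b x + c := funext hf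
  rw [hfe]
  refine h3.congr_fderiv ?_
  ext y
  have e := hH x y
  simp [fderivInnerCLM_apply] at e ⊢
  rw [real_inner_comm (H x) y, e]
  ring

variable {xstar : EuclideanSpace ℝ (Fin d)}

theorem gradient_eq_of_isMinOn (hH : H.IsSymmetric)
    (hf : ∀ x, f x = 1 / 2 * inner ℝ x (H x) + inner ℝ b x + c) (hmin : IsMinOn f univ xstar)
    (x : EuclideanSpace ℝ (Fin d)) : gradient f x = H (x - xstar) := by
  have h0 : H xstar + b = 0 := by
    have := (hmin.isLocalMin Filter.univ_mem).hasFDerivAt_eq_zero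
      (hasGradientAt_of_quadratic hH hf xstar).hasFDerivAt
    exact (InnerProductSpace.toDual ℝ _).map_eq_zero_iff.1 this
  rw [(hasGradientAt_of_quadratic hH hf x).gradient, map_sub, eq_neg_of_add_eq_zero_right h0,
    sub_eq_add_neg]

theorem sub_eq_of_isMinOn (hH : H.IsSymmetric)
    (hf : ∀ x, f x = 1 / 2 * inner ℝ x (H x) + inner ℝ b x + c) (hmin : IsMinOn f univ xstar)
    (x : EuclideanSpace ℝ (Fin d)) :
    f x - f xstar = 1 / 2 * inner ℝ (x - xstar) (H (x - xstar)) := by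
  have h0 : H xstar + b = 0 := by
    rw [← (hasGradientAt_of_quadratic hH hf xstar).gradient,
      gradient_eq_of_isMinOn hH hf hmin, sub_self, map_zero]
  have e1 := hH x xstar
  have e2 := real_inner_comm (H x) xstar
  rw [hf, hf, eq_neg_of_add_eq_zero_right h0]
  simp only [map_sub, inner_sub_left, inner_sub_right, inner_neg_left]
  rw [real_inner_comm x (H xstar), real_inner_comm xstar (H xstar)] at *
  linarith

theorem eigenvalue_mem_Icc {L : ℝ} (hH : H.IsSymmetric)
    (hf : ∀ x, f x = 1 / 2 * inner ℝ x (H x) + inner ℝ b x + c) (hmin : IsMinOn f univ xstar)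
    (hL : IsLSmooth L f) {v : EuclideanSpace ℝ (Fin d)} (hv : ‖v‖ = 1) {μ : ℝ}
    (hμ : H v = μ • v) : 0 ≤ μ ∧ μ ≤ L := by
  constructor
  · have h1 := sub_eq_of_isMinOn hH hf hmin (xstar + v)
    have h2 : f xstar ≤ f (xstar + v) := hmin (mem_univ _)
    rw [add_sub_cancel_left, hμ, inner_smul_right, real_inner_self_eq_norm_sq, hv] at h1
    linarith
  · have h1 := hL.2 (xstar + v) xstar
    rw [gradient_eq_of_isMinOn hH hf hmin, gradient_eq_of_isMinOn hH hf hmin, sub_self, map_zero,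
      sub_zero, add_sub_cancel_left, hμ, norm_smul, hv, mul_one, mul_one] at h1
    exact (le_abs_self μ).trans h1

/-- Along an eigenvector of the Hessian the error is multiplied by the normalized Jacobi
polynomial. -/
theorem inner_gcmIterate_sub {α β L : ℝ} (hα : -1 < α) (hβ : -1 < β) (hL : 0 < L)
    (hH : H.IsSymmetric) (hf : ∀ x, f x = 1 / 2 * inner ℝ x (H x) + inner ℝ b x + c)
    (hmin : IsMinOn f univ xstar) (x₀ : EuclideanSpace ℝ (Fin d))
    {v : EuclideanSpace ℝ (Fin d)} {μ : ℝ} (hμ : H v = μ • v) (t : ℕ) :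
    inner ℝ v (gcmIterate α β L f x₀ t - xstar)
      = (jacobiPoly α β t).eval (μ / L) * inner ℝ v (x₀ - xstar) := by
  have hHv : ∀ y, inner ℝ v (H y) = μ * inner ℝ v y := by
    intro y
    rw [← hH v y, hμ, real_inner_smul_left]
  induction t using Nat.twoStepInduction with
  | zero => simp [gcmIterate, jacobiPoly, jacobiCoeff_zero]
  | one =>
    rw [gcmIterate, gradient_eq_of_isMinOn hH hf hmin, eval_jacobiPoly_one hα hβ hL.ne',
      add_sub_right_comm, inner_add_right, inner_smul_right, hHv]
    ring
  | more t ih₀ ih₁ =>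
    rw [gcmIterate, gradient_eq_of_isMinOn hH hf hmin, eval_jacobiPoly_add_two hα hβ hL.ne',
      add_sub_right_comm, add_sub_right_comm, inner_add_right, inner_add_right, inner_smul_right,
      inner_smul_right, hHv,
      ← sub_sub_sub_cancel_right (gcmIterate α β L f x₀ (t + 1))
        (gcmIterate α β L f x₀ t) xstar,
      inner_sub_right v (_ - xstar), ih₀, ih₁]
    ring

end Quadratic

/-! ### The exponents -/

theorem gcmExponentValue_bounds (α β : ℝ) :
    -1 ≤ gcmExponentValue α β / 2 ∧ -1 / 2 - β ≤ gcmExponentValue α β / 2 ∧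
      α - β ≤ gcmExponentValue α β / 2 := by
  unfold gcmExponentValue
  split_ifs with h1 h2
  · refine ⟨?_, ?_, ?_⟩ <;> linarith [h1.1, h1.2]
  · obtain ⟨h2 | h2, h3⟩ := h2 <;> refine ⟨?_, ?_, ?_⟩ <;> linarith
  · rw [not_and_or, not_lt, not_le] at h1
    have h3 : 1 / 2 < β := by
      by_contra h
      exact h2 ⟨h1, not_lt.1 h⟩
    rcases h1 with h1 | h1 <;> refine ⟨?_, ?_, ?_⟩ <;> linarith

theorem gcmExponentGradient_bounds (α β : ℝ) :
    -2 ≤ gcmExponentGradient α β / 2 ∧ -1 / 2 - β ≤ gcmExponentGradient α β / 2 ∧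
      α - β ≤ gcmExponentGradient α β / 2 := by
  unfold gcmExponentGradient
  split_ifs with h1 h2
  · refine ⟨?_, ?_, ?_⟩ <;> linarith [h1.1, h1.2]
  · obtain ⟨h2 | h2, h3⟩ := h2 <;> refine ⟨?_, ?_, ?_⟩ <;> linarith
  · rw [not_and_or, not_lt, not_le] at h1
    have h3 : 3 / 2 < β := by
      by_contra h
      exact h2 ⟨h1, not_lt.1 h⟩
    rcases h1 with h1 | h1 <;> refine ⟨?_, ?_, ?_⟩ <;> linarith

theorem sq_rpow_half (t : ℕ) (e : ℝ) : ((t : ℝ) ^ 2) ^ (e / 2) = (t : ℝ) ^ e := by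
  rw [← Real.rpow_natCast, ← Real.rpow_mul t.cast_nonneg]
  congr 1
  push_cast
  ring

/-! ### Convergence rates -/

theorem mainTheorem4 (α β : ℝ) (hα : -1 < α) (hβ : -1 < β) :
    ∃ C₁ C₂ : ℝ, 0 < C₁ ∧ 0 < C₂ ∧
      ∀ (d : ℕ) (f : EuclideanSpace ℝ (Fin d) → ℝ) (L : ℝ)
        (xstar x₀ : EuclideanSpace ℝ (Fin d)),
        0 < L → IsQuadraticFunction f → ConvexOn ℝ univ f → IsLSmooth L f →
        IsMinOn f univ xstar →
        ∀ t : ℕ, 1 ≤ t →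
          f (gcmIterate α β L f x₀ t) - f xstar
              ≤ C₁ * L * ‖x₀ - xstar‖ ^ 2 * (t : ℝ) ^ gcmExponentValue α β ∧
          ‖gradient f (gcmIterate α β L f x₀ t)‖ ^ 2
              ≤ C₂ * L ^ 2 * ‖x₀ - xstar‖ ^ 2 * (t : ℝ) ^ gcmExponentGradient α β := by
  obtain ⟨a₀, a, a₁⟩ := gcmExponentValue_bounds α β
  obtain ⟨b₀, b, b₁⟩ := gcmExponentGradient_bounds α β
  obtain ⟨C₁, hC₁, h₁⟩ := exists_pow_mul_sq_eval_jacobiPoly_le hα hβ 1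
    (by rwa [Nat.cast_one]) a a₁
  obtain ⟨C₂, hC₂, h₂⟩ := exists_pow_mul_sq_eval_jacobiPoly_le hα hβ 2
    (by rwa [Nat.cast_ofNat]) b b₁
  refine ⟨C₁, C₂, hC₁, hC₂, ?_⟩
  rintro d f L xstar x₀ hL ⟨H, w, c, hH, hf⟩ - hLs hmin t ht
  set v := hH.eigenvectorBasis finrank_euclideanSpace_fin with hv
  set μ := hH.eigenvalues finrank_euclideanSpace_fin with hμ
  have hHv : ∀ i, H (v i) = μ i • v i := fun i => hH.apply_eigenvectorBasis _ i
  have hz : ∀ i, 0 ≤ μ i / L ∧ μ i / L ≤ 1 := by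
    intro i
    obtain ⟨h0, h1⟩ := eigenvalue_mem_Icc hH hf hmin hLs (v.norm_eq_one i) (hHv i)
    exact ⟨div_nonneg h0 hL.le, (div_le_one hL).2 h1⟩
  have hx : ∀ i, inner ℝ (v i) (gcmIterate α β L f x₀ t - xstar)
      = (jacobiPoly α β t).eval (μ i / L) * inner ℝ (v i) (x₀ - xstar) :=
    fun i => inner_gcmIterate_sub hα hβ hL hH hf hmin x₀ (hHv i) t
  have hHx : ∀ i, inner ℝ (v i) (H (gcmIterate α β L f x₀ t - xstar))
      = μ i * ((jacobiPoly α β t).eval (μ i / L) * inner ℝ (v i) (x₀ - xstar)) := by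
    intro i
    rw [← hx, ← hH (v i), hHv, real_inner_smul_left]
  have hsum : ∑ i, inner ℝ (v i) (x₀ - xstar) ^ 2 = ‖x₀ - xstar‖ ^ 2 := by
    rw [← v.sum_sq_norm_inner_right (x₀ - xstar)]
    simp
  rw [sub_eq_of_isMinOn hH hf hmin, gradient_eq_of_isMinOn hH hf hmin, ← hsum]
  constructor
  · rw [← v.sum_inner_mul_inner, ← sq_rpow_half t (gcmExponentValue α β), Finset.mul_sum,
      Finset.mul_sum, Finset.sum_mul]
    refine Finset.sum_le_sum fun i _ => ?_
    rw [real_inner_comm, hx, hHx]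
    have h := h₁ t ht _ (hz i).1 (hz i).2
    calc _ = 1 / 2 * (L * inner ℝ (v i) (x₀ - xstar) ^ 2)
          * ((μ i / L) ^ 1 * (jacobiPoly α β t).eval (μ i / L) ^ 2) := by
          field_simp
      _ ≤ 1 * (L * inner ℝ (v i) (x₀ - xstar) ^ 2)
          * (C₁ * ((t : ℝ) ^ 2) ^ (gcmExponentValue α β / 2)) := by
          have := pow_nonneg (hz i).1 1
          gcongr
          norm_num
      _ = _ := by ring
  · rw [← v.sum_sq_norm_inner_right, ← sq_rpow_half t (gcmExponentGradient α β),
      Finset.mul_sum, Finset.sum_mul]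
    refine Finset.sum_le_sum fun i _ => ?_
    rw [hHx, Real.norm_eq_abs, sq_abs]
    have h := h₂ t ht _ (hz i).1 (hz i).2
    calc _ = (L ^ 2 * inner ℝ (v i) (x₀ - xstar) ^ 2)
          * ((μ i / L) ^ 2 * (jacobiPoly α β t).eval (μ i / L) ^ 2) := by
          field_simp
      _ ≤ (L ^ 2 * inner ℝ (v i) (x₀ - xstar) ^ 2)
          * (C₂ * ((t : ℝ) ^ 2) ^ (gcmExponentGradient α β / 2)) := by gcongr
      _ = _ := by ring
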